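/- \textbf{Definitions.} All maps are continuous. A \emph{retraction} is a map $f\colon X\to Y$ that has a right inverse, i.e. there is a map $g\colon Y\to X$ with $f\circ g=\mathrm{id}_Y$. An \emph{inverse sequence} is an inverse system $(X_\alpha, r^\beta_\alpha)_{\alpha\le\beta<\lambda}$ indexed by an ordinal $\lambda$; it is \emph{continuous} if for every limit ordinal $\delta<\lambda$ the space $X_\delta$ together with the maps $r^\delta_\alpha$, $\alpha<\delta$, is the inverse limit of $(X_\alpha, r^\beta_\alpha)_{\alpha\le\beta<\delta}$. Class $\mathcal R$ is the smallest class of compact spaces that contains all metrizable compact spaces and is closed under limits (up to homeomorphism) of continuous inverse sequences in which each bonding map $r^{\alpha+1}_\alpha$ is a retraction. A compact space $X$ is \emph{Valdivia compact} if for some set $\kappa$ there is an embedding $X\subseteq[0,1]^\kappa$ such that the points of $X$ with countable support $\{\alpha\in\kappa: x(\alpha)\neq0\}$ are dense in $X$. For a linearly ordered set $X$, $X^{-1}$ denotes $X$ with the reversed order and $X+1$ denotes $X$ with a largest element added. The \emph{long ray} $\mathrm R^{\to}$ is $\omega_1\times[0,1)$ ordered lexicographically, with the coordinate in $\omega_1$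 compared first. The \emph{long interval} ${}^{\leftarrow}\mathrm I^{\to}$ is obtained by placing $\mathrm R^{\to}+1$ after $(\mathrm R^{\to}+1)^{-1}$ and identifying the largest element of $(\mathrm R^{\to}+1)^{-1}$ with the least element of $\mathrm R^{\to}+1$. \textbf{Theorem.} Let $K$ be a linearly ordered set that, with its order topology, is a (nonempty) connected space in class $\mathcal R$. Then $K$ is order isomorphic to one of the following: the one-point order $1$, the unit interval $[0,1]$, $\mathrm R^{\to}+1$, $(\mathrm R^{\to}+1)^{-1}$, ${}^{\leftarrow}\mathrm I^{\to}$. In particular, $K$ is Valdivia compact. -/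

import Mathlib

universe u

/-- A retraction (right-invertible map): a continuous map with a continuous right inverse. -/
def IsRetraction {X Y : Type*} [TopologicalSpace X] [TopologicalSpace Y] (f : X → Y) : Prop :=
  Continuous f ∧ ∃ g : Y → X, Continuous g ∧ ∀ y, f (g y) = y

/-- An inverse system of topological spaces and continuous maps indexed by a linear order `ι`.
When `ι` is well ordered (that is, isomorphic to an ordinal) it is an inverse sequence. -/
structure InverseSequence (ι : Type u) [LinearOrder ι] where
  obj : ι → Type u
  top : ∀ i, TopologicalSpace (obj i)
  bond : ∀ i j, i ≤ j → obj j → obj i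
  continuous_bond : ∀ i j (h : i ≤ j), Continuous (bond i j h)
  bond_self : ∀ i (x : obj i), bond i i le_rfl x = x
  bond_bond : ∀ i j k (hij : i ≤ j) (hjk : j ≤ k) (x : obj k),
    bond i j hij (bond j k hjk x) = bond i k (hij.trans hjk) x

namespace InverseSequence

variable {ι : Type u} [LinearOrder ι] (S : InverseSequence ι)

instance (i : ι) : TopologicalSpace (S.obj i) := S.top i

/-- The inverse limit: the threads in the product, with the topology of the product. -/
def Limit : Type u :=
  {x : ∀ i, S.obj i // ∀ i j (h : i ≤ j), S.bond i j h (x j) = x i}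

instance : TopologicalSpace S.Limit :=
  inferInstanceAs (TopologicalSpace
    {x : ∀ i, S.obj i // ∀ i j (h : i ≤ j), S.bond i j h (x j) = x i})

/-- The restriction of the sequence to the indices below `d`. -/
def restrict (d : ι) : InverseSequence (Set.Iio d) where
  obj i := S.obj i
  top i := S.top i
  bond i j h := S.bond i j h
  continuous_bond i j h := S.continuous_bond i j h
  bond_self i x := S.bond_self i x
  bond_bond i j k hij hjk x := S.bond_bond i j k hij hjk x

/-- The canonical map from the `d`-th space to the limit of the restriction below `d`. -/
def toLimitRestrict (d : ι) (x : S.obj d) : (S.restrict d).Limit :=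
  ⟨fun i => S.bond i d i.2.le x, fun i j h => S.bond_bond i j d h j.2.le x⟩

/-- Continuity of an inverse sequence: at each limit index `d`, the space `S.obj d` together with
its bonding maps is the limit of the restriction of the sequence below `d`. -/
def IsContinuous : Prop :=
  ∀ d : ι, Order.IsSuccLimit d → IsHomeomorph (S.toLimitRestrict d)

/-- All bonding maps between an index and its immediate successor are retractions. -/
def IsRetractive : Prop :=
  ∀ i j (h : i ⋖ j), IsRetraction (S.bond i j h.le)

end InverseSequence

/-- Class `R`: the smallest class of spaces containing all metric compacta and closed under
(spaces homeomorphic to) limits of continuous inverse sequences of retractions. -/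
inductive ClassR : (X : Type u) → TopologicalSpace X → Prop
  | metric (X : Type u) [t : TopologicalSpace X] [CompactSpace X]
      [TopologicalSpace.MetrizableSpace X] : ClassR X t
  | limit (X : Type u) [t : TopologicalSpace X] (ι : Type u) [LinearOrder ι] [WellFoundedLT ι]
      (S : InverseSequence ι) (hcont : S.IsContinuous) (hretr : S.IsRetractive)
      (hobj : ∀ i, ClassR (S.obj i) (S.top i)) (e : X ≃ₜ S.Limit) : ClassR X t

/-- A Valdivia compact space: a compact space with an embedding into a cube `[0,1]^κ` such that
the points with countable support are dense in it. -/
def IsValdiviaCompact (X : Type u) [TopologicalSpace X] : Prop :=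
  CompactSpace X ∧ ∃ (κ : Type u) (f : X → κ → unitInterval),
    Topology.IsEmbedding f ∧ Dense {x : X | {i : κ | f x i ≠ 0}.Countable}

/-- The long ray: the lexicographic product of `ω₁` copies of `[0,1)`; the coordinate in `ω₁`
is compared first. -/
abbrev LongRay : Type := (Ordinal.omega.{0} 1).ToType ×ₗ Set.Ico (0 : ℝ) 1

/-- The long ray with a largest element added. -/
abbrev CompactLongRay : Type := WithTop LongRay

/-- The long interval: the reverse of `CompactLongRay` followed by `CompactLongRay`, with the
largest point of the former glued to the least point of the latter (so that the glueing point
is kept only once, in the second summand). -/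
abbrev LongInterval : Type := {x : CompactLongRay // ¬ IsMin x}ᵒᵈ ⊕ₗ CompactLongRay

/-! The key fact, `ClassR.isSeparable_Icc`, is that `[x, y]` is separable whenever it contains no
end point of `K`. It is proved by induction on class R, for all connected orders homeomorphic to the
given space. Let `K` be a limit, with `a < x` and `y < b`. Sections of the successor maps extend by
transfinite recursion to a section of the projection to each stage (`isRetraction_proj`). The image
of such a section is connected, hence convex in `K`. At a late stage `k`, projecting `a` and `b` to
the stage and lifting them back gives points still below `x` and above `y`. So `[x, y]` lies in a
convex copy of the stage and avoids its end points, and the induction hypothesis applies.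

The rest is order theory in the complete dense order `K`. Separable intervals are copies of `[0,1]`
by Cantor's back-and-forth theorem and completion. Towards an end of `K` there are two
possibilities. With countable cofinality, separability extends to the end. Otherwise a continuous
`ω₁`-sequence converges to the end and cuts that side into `ω₁` copies of `[0,1)`. Combining the two
ends gives the list.

For the Valdivia property, the coordinates are the maps collapsing everything outside one copy of
`[0,1)`. Only end points can have uncountable support, and removing them leaves a dense set. -/

open TopologicalSpace Set

/-! ### Limits of inverse sequences and sections of their projections -/

namespace InverseSequence

variable {ι : Type u} [LinearOrder ι] (S : InverseSequence ι)

/-- The projection of the limit to the `i`-th space. -/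
def proj (i : ι) (x : S.Limit) : S.obj i := x.1 i

theorem continuous_proj (i : ι) : Continuous (S.proj i) :=
  (continuous_apply i).comp continuous_subtype_val

theorem isClosed_threads (h : ∀ i, T2Space (S.obj i)) :
    IsClosed {x : ∀ i, S.obj i | ∀ i j (h : i ≤ j), S.bond i j h (x j) = x i} := by
  simp only [ofPred_forall]
  exact isClosed_iInter fun i => isClosed_iInter fun j => isClosed_iInter fun hij =>
    isClosed_eq ((S.continuous_bond i j hij).comp (continuous_apply j)) (continuous_apply i)

theorem t2Space_limit (h : ∀ i, T2Space (S.obj i)) : T2Space S.Limit :=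
  inferInstanceAs (T2Space {x : ∀ i, S.obj i // ∀ i j (h : i ≤ j), S.bond i j h (x j) = x i})

theorem compactSpace_limit (h : ∀ i, T2Space (S.obj i)) (h' : ∀ i, CompactSpace (S.obj i)) :
    CompactSpace S.Limit :=
  isCompact_iff_compactSpace.1 (S.isClosed_threads h).isCompact

/-- A nonempty open subset of the limit contains a nonempty basic open set, given by an arbitrarily
large index. -/
theorem exists_preimage_proj_subset [Nonempty ι] {U : Set S.Limit} (hU : IsOpen U) {x : S.Limit}
    (hx : x ∈ U) : ∃ i, ∀ k, i ≤ k → ∃ V : Set (S.obj k), S.proj k x ∈ V ∧ S.proj k ⁻¹' V ⊆ U := by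
  obtain ⟨W, hW, rfl⟩ := isOpen_induced_iff.1 hU
  obtain ⟨I, u, hu, hIu⟩ := isOpen_pi_iff.1 hW x.1 hx
  obtain ⟨i, hi⟩ := I.exists_le
  refine ⟨i, fun k hk => ⟨{y | ∀ j (hj : j ∈ I), S.bond j k ((hi j hj).trans hk) y ∈ u j}, ?_, ?_⟩⟩
  · intro j hj
    have := x.2 j k ((hi j hj).trans hk)
    simp only [proj, this]
    exact (hu j hj).2
  · intro y hy
    refine hIu fun j hj => ?_
    have := hy j hj
    rwa [proj, y.2 j k ((hi j hj).trans hk)] at this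

open Classical in
/-- A coherent choice of maps from `S.obj i` to all spaces of the sequence. -/
noncomputable def sectionMap [WellFoundedLT ι] [∀ k, Nonempty (S.obj k)] (i : ι) :
    ∀ k, S.obj i → S.obj k :=
  WellFounded.fix (C := fun k => S.obj i → S.obj k) (wellFounded_lt (α := ι)) fun k s =>
    -- The recursion carries no proofs about earlier stages, so existence of `t` is not yet
    -- available; `epsilon` postpones it to `sectionMap_spec`.
    Classical.epsilon fun t : S.obj i → S.obj k => Continuous t ∧
      (∀ l (h : l < k) x, S.bond l k h.le (t x) = s l h x) ∧
      ∀ (h : k ≤ i) x, t x = S.bond k i h x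

/-- Up to `i` the bonding maps serve. Beyond `i`, a successor stage composes with a right inverse of
the retraction, and at a limit stage the coherent earlier maps form threads, which continuity of the
sequence turns into points. -/
theorem sectionMap_spec [WellFoundedLT ι] [∀ k, Nonempty (S.obj k)] (hcont : S.IsContinuous)
    (hretr : S.IsRetractive) (i k : ι) : Continuous (S.sectionMap i k) ∧
      (∀ l (h : l < k) x, S.bond l k h.le (S.sectionMap i k x) = S.sectionMap i l x) ∧
      ∀ (h : k ≤ i) x, S.sectionMap i k x = S.bond k i h x := by
  induction k using WellFoundedLT.induction with
  | ind k ih =>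
  have key : ∃ t : S.obj i → S.obj k, Continuous t ∧
      (∀ l (h : l < k) x, S.bond l k h.le (t x) = S.sectionMap i l x) ∧
      ∀ (h : k ≤ i) x, t x = S.bond k i h x := by
    rcases le_or_gt k i with hki | hki
    · refine ⟨S.bond k i hki, S.continuous_bond k i hki, fun l h x => ?_, fun _ _ => rfl⟩
      rw [S.bond_bond, (ih l h).2.2 (h.le.trans hki)]
    by_cases hk : Order.IsSuccPrelimit k
    -- A prelimit could still be the least index; `i < k` excludes this.
    · have hk' : Order.IsSuccLimit k := ⟨fun h => (h hki.le).not_gt hki, hk⟩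
      have hom := hcont k hk'
      let e := hom.homeomorph
      let th : S.obj i → (S.restrict k).Limit := fun x => ⟨fun l => S.sectionMap i l x, by
        intro a b hab
        rcases hab.eq_or_lt with rfl | hab'
        · exact S.bond_self _ _
        · exact (ih b b.2).2.1 a hab' x⟩
      have hth : Continuous th :=
        Continuous.subtype_mk (continuous_pi fun l : Iio k => (ih l.1 l.2).1) _
      refine ⟨fun x => e.symm (th x), e.symm.continuous.comp hth, fun l h x => ?_,
        fun h => absurd h hki.not_ge⟩
      have : S.toLimitRestrict k (e.symm (th x)) = th x := e.apply_symm_apply (th x)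
      exact congrFun (congrArg Subtype.val this) ⟨l, h⟩
    · obtain ⟨l, hl⟩ : ∃ l, l ⋖ k := by
        simpa [Order.IsSuccPrelimit] using hk
      obtain ⟨-, g, hg, hgr⟩ := hretr l k hl
      refine ⟨fun x => g (S.sectionMap i l x), hg.comp (ih l hl.lt).1, fun l' h x => ?_,
        fun h => absurd h hki.not_ge⟩
      have hle : l' ≤ l := hl.le_of_lt h
      rw [← S.bond_bond l' l k hle hl.le, hgr]
      rcases hle.eq_or_lt with rfl | hlt
      · exact S.bond_self _ _
      · exact (ih l hl.lt).2.1 l' hlt x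
  have := Classical.epsilon_spec key
  rw [sectionMap, WellFounded.fix_eq]
  exact this

/-- In a continuous inverse sequence of retractions, the projections of the limit are retractions. -/
theorem isRetraction_proj [WellFoundedLT ι] [∀ k, Nonempty (S.obj k)] (hcont : S.IsContinuous)
    (hretr : S.IsRetractive) (i : ι) : IsRetraction (S.proj i) := by
  refine ⟨S.continuous_proj i, fun x => ⟨fun k => S.sectionMap i k x, fun a b hab => ?_⟩,
    Continuous.subtype_mk
      (continuous_pi fun k => (S.sectionMap_spec hcont hretr i k).1) _, fun x => ?_⟩
  · rcases hab.eq_or_lt with rfl | h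
    · exact S.bond_self _ _
    · exact (S.sectionMap_spec hcont hretr i b).2.1 a h x
  · exact ((S.sectionMap_spec hcont hretr i i).2.2 le_rfl x).trans (S.bond_self _ _)

end InverseSequence

/-! ### Separable intervals in connected orders of class R -/

theorem ClassR.compactSpace_and_t2Space {X : Type u} {t : TopologicalSpace X} (h : ClassR X t) :
    CompactSpace X ∧ T2Space X := by
  induction h with
  | metric X => exact ⟨inferInstance, inferInstance⟩
  | limit X ι S _ _ _ e ih =>
    have := S.t2Space_limit fun i => (ih i).2
    have := S.compactSpace_limit (fun i => (ih i).2) fun i => (ih i).1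
    exact ⟨e.symm.compactSpace, e.symm.t2Space⟩

/-- In a connected linearly ordered space of class `R`, the intervals that contain no end points
of the space are separable. -/
theorem ClassR.isSeparable_Icc {X : Type u} {t : TopologicalSpace X} (h : ClassR X t) :
    ∀ (K : Type u) [LinearOrder K] [TopologicalSpace K] [OrderTopology K] [ConnectedSpace K]
      (_ : X ≃ₜ K) (x y : K), ¬ IsMin x → ¬ IsMax y → IsSeparable (Icc x y) := by
  induction h with
  | metric X =>
    intro K _ _ _ _ e x y _ _
    have := e.symm.isEmbedding.secondCountableTopology
    exact IsSeparable.of_separableSpace _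
  | limit X ι S hcont hretr hobj e ih =>
    intro K _ _ _ _ e' x y hx hy
    let E : S.Limit ≃ₜ K := e.symm.trans e'
    have hLne : Nonempty S.Limit := E.toEquiv.nonempty
    have hne : ∀ k, Nonempty (S.obj k) := fun k => hLne.map (S.proj k)
    obtain ⟨a, ha⟩ := not_isMin_iff.1 hx
    obtain ⟨b, hb⟩ := not_isMax_iff.1 hy
    -- Over an empty index set the limit is a single point, contradicting `a < x`.
    have hι : Nonempty ι := by
      by_contra hcon
      rw [not_nonempty_iff] at hcon
      have : E.symm a = E.symm x := Subtype.ext (funext fun i => isEmptyElim i)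
      exact ha.ne (E.symm.injective this)
    obtain ⟨i, hi⟩ := S.exists_preimage_proj_subset (isOpen_Iio.preimage E.continuous)
      (x := E.symm a) (U := E ⁻¹' Iio x) (by simpa using ha)
    obtain ⟨j, hj⟩ := S.exists_preimage_proj_subset (isOpen_Ioi.preimage E.continuous)
      (x := E.symm b) (U := E ⁻¹' Ioi y) (by simpa using hb)
    let k := max i j
    obtain ⟨V, haV, hV⟩ := hi k (le_max_left i j)
    obtain ⟨V', hbV, hV'⟩ := hj k (le_max_right i j)
    obtain ⟨hp, g, hg, hgr⟩ := S.isRetraction_proj hcont hretr k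
    -- The lifted point has the same `k`-th coordinate as `a`, and that coordinate alone already
    -- forces a point below `x`.
    have hlt : E (g (S.proj k (E.symm a))) < x := hV (by simpa [hgr] using haV)
    have hgt : y < E (g (S.proj k (E.symm b))) := hV' (by simpa [hgr] using hbV)
    have : ConnectedSpace (S.obj k) :=
      Function.Surjective.connectedSpace
        (f := fun x : K => S.proj k (E.symm x))
        (fun z => ⟨E (g z), by simp [hgr]⟩) (hp.comp E.symm.continuous)
    let G : S.obj k → K := fun z => E (g z)
    have hG : Continuous G := E.continuous.comp hg
    have hleft : Function.LeftInverse (fun x : K => S.proj k (E.symm x)) G := fun z => by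
      simp [G, hgr]
    have hemb : Topology.IsEmbedding G :=
      hleft.isEmbedding (hp.comp E.symm.continuous) hG
    have hconn : IsConnected (range G) := isConnected_range hG
    have hord : (range G).OrdConnected := hconn.isPreconnected.ordConnected
    have : ConnectedSpace (range G) := isConnected_iff_connectedSpace.1 hconn
    rcases lt_or_ge y x with hyx | hxy
    · rw [Icc_eq_empty hyx.not_ge]
      exact countable_empty.isSeparable
    have hsub : Icc x y ⊆ range G := fun z hz =>
      hord.out (mem_range_self _) (mem_range_self _) ⟨(hlt.le.trans hz.1), hz.2.trans hgt.le⟩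
    have := ih k (range G) hemb.toHomeomorph ⟨x, hsub ⟨le_rfl, hxy⟩⟩ ⟨y, hsub ⟨hxy, le_rfl⟩⟩
      (not_isMin_iff.2 ⟨⟨_, mem_range_self (S.proj k (E.symm a))⟩, hlt⟩)
      (not_isMax_iff.2 ⟨⟨_, mem_range_self (S.proj k (E.symm b))⟩, hgt⟩)
    refine (this.image continuous_subtype_val).mono fun z hz => ?_
    exact ⟨⟨z, hsub hz⟩, hz, rfl⟩

/-! ### Order separability -/

/-- A set in a linear order is order separable if some countable set meets every nonempty open
interval with end points in it. -/
def OrderSeparable {K : Type*} [LinearOrder K] (s : Set K) : Prop :=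
  ∃ D : Set K, D.Countable ∧ ∀ a ∈ s, ∀ b ∈ s, a < b → ∃ d ∈ D, a < d ∧ d < b

namespace OrderSeparable

variable {K : Type*} [LinearOrder K]

theorem mono {s t : Set K} (h : OrderSeparable t) (hst : s ⊆ t) : OrderSeparable s :=
  let ⟨D, hD, hD'⟩ := h
  ⟨D, hD, fun a ha b hb => hD' a (hst ha) b (hst hb)⟩

theorem of_isSeparable [TopologicalSpace K] [OrderTopology K] [DenselyOrdered K] {x y : K}
    (h : IsSeparable (Icc x y)) : OrderSeparable (Icc x y) := by
  obtain ⟨D, hD, hsub⟩ := h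
  refine ⟨D, hD, fun a ha b hb hab => ?_⟩
  obtain ⟨c, hc⟩ := exists_between hab
  obtain ⟨d, hd, hdD⟩ := mem_closure_iff.1 (hsub ⟨ha.1.trans hc.1.le, hc.2.le.trans hb.2⟩)
    (Ioo a b) isOpen_Ioo hc
  exact ⟨d, hdD, hd⟩

theorem dual {s : Set K} (h : OrderSeparable s) :
    OrderSeparable (OrderDual.ofDual ⁻¹' s) := by
  obtain ⟨D, hD, h⟩ := h
  refine ⟨OrderDual.ofDual ⁻¹' D, hD.preimage OrderDual.ofDual.injective, fun a ha b hb hab => ?_⟩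
  obtain ⟨d, hd, h1, h2⟩ := h _ hb _ ha hab
  exact ⟨OrderDual.toDual d, hd, h2, h1⟩

theorem preimage_val {t s : Set K} [ht : t.OrdConnected] (h : OrderSeparable s) :
    OrderSeparable ((↑) ⁻¹' s : Set t) := by
  obtain ⟨D, hD, h⟩ := h
  refine ⟨(↑) ⁻¹' D, hD.preimage Subtype.val_injective, fun a ha b hb hab => ?_⟩
  obtain ⟨d, hd, h1, h2⟩ := h _ ha _ hb hab
  exact ⟨⟨d, ht.out a.2 b.2 ⟨h1.le, h2.le⟩⟩, hd, h1, h2⟩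

theorem image_val {t : Set K} {s : Set t} (h : OrderSeparable s) :
    OrderSeparable ((↑) '' s : Set K) := by
  obtain ⟨D, hD, h⟩ := h
  refine ⟨(↑) '' D, hD.image _, ?_⟩
  rintro _ ⟨a, ha, rfl⟩ _ ⟨b, hb, rfl⟩ hab
  obtain ⟨d, hd, h1, h2⟩ := h a ha b hb hab
  exact ⟨d, mem_image_of_mem _ hd, h1, h2⟩

/-- Order separable sets that share a point glue to an order separable set. -/
theorem union [DenselyOrdered K] {s t : Set K} {m : K} (hs : OrderSeparable s)
    (ht : OrderSeparable t) (hms : m ∈ s) (hmt : m ∈ t) (hsm : ∀ a ∈ s, a ≤ m)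
    (htm : ∀ a ∈ t, m ≤ a) : OrderSeparable (s ∪ t) := by
  obtain ⟨D, hD, h⟩ := hs
  obtain ⟨D', hD', h'⟩ := ht
  refine ⟨D ∪ D', hD.union hD', fun a ha b hb hab => ?_⟩
  rcases lt_or_ge a m with ham | ham
  · have has : a ∈ s := ha.resolve_right fun h => (htm a h).not_gt ham
    rcases le_or_gt b m with hbm | hbm
    · have : b ∈ s := hb.elim id fun h => by rwa [hbm.antisymm (htm b h)]
      obtain ⟨d, hd, h1⟩ := h a has b this hab
      exact ⟨d, Or.inl hd, h1⟩
    · obtain ⟨d, hd, h1⟩ := h a has m hms ham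
      exact ⟨d, Or.inl hd, h1.1, h1.2.trans hbm⟩
  · have hat : a ∈ t := ha.elim (fun h => by rwa [(hsm a h).antisymm ham]) id
    have hbt : b ∈ t := hb.resolve_left fun h => (hsm b h).not_gt (ham.trans_lt hab)
    obtain ⟨d, hd, h1⟩ := h' a hat b hbt hab
    exact ⟨d, Or.inr hd, h1⟩

theorem of_orderIso {L : Type*} [LinearOrder L] (e : K ≃o L) (h : OrderSeparable (univ : Set L)) :
    OrderSeparable (univ : Set K) := by
  obtain ⟨D, hD, h⟩ := h
  refine ⟨e ⁻¹' D, hD.preimage e.injective, fun a _ b _ hab => ?_⟩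
  obtain ⟨d, hd, h1, h2⟩ := h _ trivial _ trivial (e.strictMono hab)
  exact ⟨e.symm d, by simpa, (e.lt_symm_apply).2 h1, (e.symm_apply_lt).2 h2⟩

theorem univ_unitInterval : OrderSeparable (univ : Set (Icc (0 : ℝ) 1)) := by
  have : OrderSeparable (univ : Set ℝ) :=
    ⟨range ((↑) : ℚ → ℝ), countable_range _, fun a _ b _ hab =>
      let ⟨q, h⟩ := exists_rat_btwn hab
      ⟨q, mem_range_self q, h⟩⟩
  exact preimage_val (t := Icc (0 : ℝ) 1) this

/-- An order separable set contains no strictly increasing family indexed by an uncountable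
linear order without maximum. -/
theorem countable_of_strictMono {s : Set K} (h : OrderSeparable s) {W : Type*} [LinearOrder W]
    [SuccOrder W] [NoMaxOrder W] {f : W → K} (hf : StrictMono f) (hs : ∀ w, f w ∈ s) :
    Countable W := by
  obtain ⟨D, hD, h⟩ := h
  choose g hgD hg using fun w => h _ (hs w) _ (hs (Order.succ w)) (hf (Order.lt_succ w))
  have hg' : StrictMono g := fun v w hvw =>
    ((hg v).2.trans_le (hf.monotone (Order.succ_le_of_lt hvw))).trans (hg w).1
  have := hD.to_subtype
  exact (hg'.injective.codRestrict hgD).countable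

end OrderSeparable

/-! ### Separable intervals as copies of real intervals -/

section Interval

variable {K : Type*} [LinearOrder K]

/-- A nondegenerate order separable interval of a complete dense order is a copy of the unit
interval. -/
theorem exists_strictMonoOn_image_Icc (hsup : ∀ s : Set K, ∃ a, IsLUB s a) {a b : K} (hab : a < b)
    (hsep : OrderSeparable (Icc a b)) :
    ∃ f : ℝ → K, StrictMonoOn f (Icc 0 1) ∧ f '' Icc 0 1 = Icc a b := by
  obtain ⟨D, hD, h⟩ := hsep
  have hbtw : ∀ x ∈ Icc a b, ∀ y ∈ Icc a b, x < y → ∃ d : ↥(D ∩ Ioo a b), x < d ∧ d < y :=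
    fun x hx y hy hxy =>
      let ⟨d, hd, h1, h2⟩ := h x hx y hy hxy
      ⟨⟨d, hd, hx.1.trans_lt h1, h2.trans_le hy.2⟩, h1, h2⟩
  have ha : a ∈ Icc a b := ⟨le_rfl, hab.le⟩
  have hb : b ∈ Icc a b := ⟨hab.le, le_rfl⟩
  have hm : ∀ d : ↥(D ∩ Ioo a b), (d : K) ∈ Icc a b := fun d => Ioo_subset_Icc_self d.2.2
  have : Countable ↥(D ∩ Ioo a b) := (hD.mono inter_subset_left).to_subtype
  have : Nonempty ↥(D ∩ Ioo a b) := let ⟨d, _⟩ := hbtw a ha b hb hab; ⟨d⟩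
  have : DenselyOrdered ↥(D ∩ Ioo a b) := ⟨fun x y hxy => hbtw x (hm x) y (hm y) hxy⟩
  have : NoMinOrder ↥(D ∩ Ioo a b) := ⟨fun x =>
    let ⟨d, hd⟩ := hbtw a ha x (hm x) x.2.2.1; ⟨d, hd.2⟩⟩
  have : NoMaxOrder ↥(D ∩ Ioo a b) := ⟨fun x =>
    let ⟨d, hd⟩ := hbtw x (hm x) b hb x.2.2.2; ⟨d, hd.1⟩⟩
  have : Nonempty (Ioo (0 : ℚ) 1) := ⟨⟨1 / 2, by norm_num, by norm_num⟩⟩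
  obtain ⟨e⟩ := Order.iso_of_countable_dense (Ioo (0 : ℚ) 1) ↥(D ∩ Ioo a b)
  -- `f t` is the supremum of the images of the rationals below `t`; `a` is inserted because at `t =
  -- 0` there are none, and the empty supremum would be the bottom of `K`.
  choose f hf using fun t : ℝ =>
    hsup (insert a {x | ∃ q : Ioo (0 : ℚ) 1, ((q : ℚ) : ℝ) < t ∧ x = e q})
  have hfa : ∀ t, a ≤ f t := fun t => (hf t).1 (mem_insert _ _)
  have hfe : ∀ t (q : Ioo (0 : ℚ) 1), ((q : ℚ) : ℝ) < t → (e q : K) ≤ f t := fun t q hq =>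
    (hf t).1 (Or.inr ⟨q, hq, rfl⟩)
  have hfle : ∀ t y, a ≤ y → (∀ q : Ioo (0 : ℚ) 1, ((q : ℚ) : ℝ) < t → (e q : K) ≤ y) → f t ≤ y := by
    intro t y hy hq
    refine (hf t).2 ?_
    rintro _ (rfl | ⟨q, hqt, rfl⟩)
    exacts [hy, hq q hqt]
  refine ⟨f, ?_, ?_⟩
  · intro s hs t ht hst
    -- Two rationals are needed: `f s ≤ e q < e q' ≤ f t`.
    obtain ⟨q, hsq, hqt⟩ := exists_rat_btwn hst
    obtain ⟨q', hqq', hq't⟩ := exists_rat_btwn hqt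
    have hq : q ∈ Ioo (0 : ℚ) 1 :=
      ⟨by exact_mod_cast hs.1.trans_lt hsq, by exact_mod_cast hqt.trans_le ht.2⟩
    have hq' : q' ∈ Ioo (0 : ℚ) 1 :=
      ⟨hq.1.trans (by exact_mod_cast hqq'), by exact_mod_cast hq't.trans_le ht.2⟩
    have h1 : f s ≤ e ⟨q, hq⟩ := hfle _ _ (hm _).1 fun r hr =>
      e.monotone (show (r : ℚ) ≤ q by exact_mod_cast (hr.trans hsq).le)
    have h2 : (e ⟨q, hq⟩ : K) < e ⟨q', hq'⟩ := e.strictMono (show q < q' by exact_mod_cast hqq')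
    exact h1.trans_lt (h2.trans_le (hfe t ⟨q', hq'⟩ hq't))
  · refine Subset.antisymm ?_ fun y hy => ?_
    · rintro _ ⟨t, -, rfl⟩
      exact ⟨hfa t, hfle t b hab.le fun q _ => (hm _).2⟩
    · let A : Set ℝ := insert 0 {r | ∃ q : Ioo (0 : ℚ) 1, (e q : K) < y ∧ r = ((q : ℚ) : ℝ)}
      have hA1 : ∀ r ∈ A, r ≤ 1 := by
        rintro _ (rfl | ⟨q, -, rfl⟩)
        · exact zero_le_one
        · exact_mod_cast q.2.2.le
      have hbdd : BddAbove A := ⟨1, hA1⟩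
      have hAq : ∀ q : Ioo (0 : ℚ) 1, (e q : K) < y → ((q : ℚ) : ℝ) ≤ sSup A := fun q hq =>
        le_csSup hbdd (Or.inr ⟨q, hq, rfl⟩)
      have hA0 : 0 ≤ sSup A := le_csSup hbdd (mem_insert _ _)
      refine ⟨sSup A, ⟨hA0, csSup_le ⟨0, mem_insert _ _⟩ hA1⟩, ?_⟩
      refine le_antisymm (hfle _ _ hy.1 fun q hq => ?_) (le_of_not_gt fun hlt => ?_)
      · obtain ⟨r, hr, hqr⟩ := exists_lt_of_lt_csSup ⟨0, mem_insert _ _⟩ hq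
        rcases hr with rfl | ⟨q', hq', rfl⟩
        · exact absurd hqr (not_lt.2 (by exact_mod_cast q.2.1.le))
        · have h1 : (e q : K) < e q' := e.strictMono (show q < q' by exact_mod_cast hqr)
          exact (h1.trans hq').le
      -- The second point `d'` puts the parameter of `d` strictly below `sSup A`, so that `d ≤ f
      -- (sSup A)`, against the choice of `d`.
      · obtain ⟨d, hd, hdy⟩ := hbtw _ ⟨hfa _, hlt.le.trans hy.2⟩ y hy hlt
        obtain ⟨d', hdd', hdy'⟩ := hbtw d (hm d) y hy hdy
        have h1 : e.symm d < e.symm d' := e.symm.strictMono hdd'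
        have h2 := hAq (e.symm d') (by simpa using hdy')
        have h3 := hfe (sSup A) (e.symm d)
          (lt_of_lt_of_le (by exact_mod_cast h1) h2)
        rw [e.apply_symm_apply] at h3
        exact h3.not_gt hd

theorem nonempty_orderIso_Icc [BoundedOrder K] [Nontrivial K]
    (hsup : ∀ s : Set K, ∃ a, IsLUB s a) (hsep : OrderSeparable (univ : Set K)) :
    Nonempty (K ≃o Icc (0 : ℝ) 1) := by
  obtain ⟨f, hf, hf'⟩ := exists_strictMonoOn_image_Icc hsup (bot_lt_top (α := K))
    (hsep.mono (subset_univ _))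
  refine ⟨(StrictMono.orderIsoOfSurjective (fun t : Icc (0 : ℝ) 1 => f t)
    (fun s t hst => hf s.2 t.2 hst) fun y => ?_).symm⟩
  obtain ⟨t, ht, rfl⟩ : y ∈ f '' Icc 0 1 := by rw [hf']; exact ⟨bot_le, le_top⟩
  exact ⟨⟨t, ht⟩, rfl⟩

theorem exists_strictMonoOn_image_Ico (hsup : ∀ s : Set K, ∃ a, IsLUB s a) {a b : K} (hab : a < b)
    (hsep : OrderSeparable (Icc a b)) :
    ∃ f : ℝ → K, StrictMonoOn f (Ico 0 1) ∧ f '' Ico 0 1 = Ico a b := by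
  obtain ⟨f, hf, hf'⟩ := exists_strictMonoOn_image_Icc hsup hab hsep
  have h1 : (1 : ℝ) ∈ Icc (0 : ℝ) 1 := ⟨zero_le_one, le_rfl⟩
  have hf1 : f 1 = b := by
    obtain ⟨t, ht, htb⟩ : b ∈ f '' Icc 0 1 := by rw [hf']; exact ⟨hab.le, le_rfl⟩
    refine le_antisymm ?_ (htb ▸ hf.monotoneOn ht h1 ht.2)
    have : f 1 ∈ Icc a b := hf' ▸ mem_image_of_mem f h1
    exact this.2
  refine ⟨f, hf.mono Ico_subset_Icc_self, Subset.antisymm ?_ fun y hy => ?_⟩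
  · rintro _ ⟨t, ht, rfl⟩
    have : f t ∈ Icc a b := hf' ▸ mem_image_of_mem f (Ico_subset_Icc_self ht)
    exact ⟨this.1, hf1 ▸ hf (Ico_subset_Icc_self ht) h1 ht.2⟩
  · obtain ⟨t, ht, rfl⟩ : y ∈ f '' Icc 0 1 := by rw [hf']; exact Ico_subset_Icc_self hy
    refine ⟨t, ⟨ht.1, lt_of_le_of_ne ht.2 ?_⟩, rfl⟩
    rintro rfl
    exact hy.2.ne hf1

end Interval

/-! ### The order type `ω₁` -/

section OmegaOne

open Cardinal in
theorem countable_Iio_omega_one (w : (Ordinal.omega.{0} 1).ToType) : (Iio w).Countable := by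
  have h : #(Iio w) < #(Ordinal.omega.{0} 1).ToType := mk_Iio_lt w (by simp)
  rw [mk_toType, Ordinal.card_omega] at h
  rw [← succ_aleph0, Order.lt_succ_iff] at h
  exact le_aleph0_iff_set_countable.1 h

open Cardinal in
theorem uncountable_omega_one : Uncountable (Ordinal.omega.{0} 1).ToType := by
  rw [← aleph0_lt_mk_iff, mk_toType, Ordinal.card_omega]
  exact aleph0_lt_aleph_one

theorem noMaxOrder_omega_one : NoMaxOrder (Ordinal.omega.{0} 1).ToType := by
  refine ⟨fun w => ?_⟩
  by_contra! hw
  have h : (Iic w).Countable := by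
    rw [← Iio_insert]
    exact (countable_Iio_omega_one w).insert w
  have := uncountable_omega_one
  exact not_countable_univ (h.mono fun v _ => hw v)

end OmegaOne

/-! ### Orders separable away from the top -/

section HalfLine

variable {K : Type*} [LinearOrder K] [DenselyOrdered K] [BoundedOrder K]

theorem orderSeparable_univ_of_countable_cofinal (h : ∀ y < (⊤ : K), OrderSeparable (Icc ⊥ y))
    {C : Set K} (hC : C.Countable) (hCt : ∀ c ∈ C, c < ⊤) (hcof : ∀ y < (⊤ : K), ∃ c ∈ C, y ≤ c) :
    OrderSeparable (univ : Set K) := by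
  choose! D hD hD' using h
  refine ⟨⋃ c ∈ C, D c, hC.biUnion fun c hc => hD c (hCt c hc), fun a _ b _ hab => ?_⟩
  -- `b` may be `⊤`, which lies in no `Icc ⊥ c`; a point below it takes its place.
  obtain ⟨z, haz, hzb⟩ := exists_between hab
  obtain ⟨c, hc, hzc⟩ := hcof z (hzb.trans_le le_top)
  obtain ⟨d, hd, h1, h2⟩ :=
    hD' c (hCt c hc) a ⟨bot_le, haz.le.trans hzc⟩ z ⟨bot_le, hzc⟩ haz
  exact ⟨d, mem_biUnion hc hd, h1, h2.trans hzb⟩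

/-- If the top element is not the limit of a countable set, then it is the limit of a
continuous strictly increasing sequence of type `ω₁`. -/
theorem exists_strictMono_omega_one (hsup : ∀ s : Set K, ∃ a, IsLUB s a)
    (hcof : ∀ C : Set K, C.Countable → (∀ c ∈ C, c < ⊤) → ∃ y < (⊤ : K), ∀ c ∈ C, c < y) :
    ∃ x : (Ordinal.omega.{0} 1).ToType → K, StrictMono x ∧ (∀ w, x w < ⊤) ∧
      ∀ w z, z < x w → ∃ v < w, z < x (Order.succ v) := by
  have := noMaxOrder_omega_one
  choose! nx hnx hnxt using fun (y : K) (hy : y < ⊤) => exists_between hy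
  choose sup hsup using hsup
  -- One formula covers zero, successor and limit stages: the supremum of the chosen larger points
  -- `nx (x v)`. Taking suprema is what makes the sequence continuous.
  let x : (Ordinal.omega.{0} 1).ToType → K :=
    WellFounded.fix (wellFounded_lt (α := (Ordinal.omega.{0} 1).ToType))
      fun w x => sup {z | ∃ v, ∃ h : v < w, z = nx (x v h)}
  have hx : ∀ w, IsLUB {z | ∃ v, ∃ _ : v < w, z = nx (x v)} (x w) := fun w => by
    have := hsup {z | ∃ v, ∃ _ : v < w, z = nx (x v)}
    rwa [show x w = _ from WellFounded.fix_eq _ _ _]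
  have hxt : ∀ w, x w < ⊤ := fun w => by
    induction w using WellFoundedLT.induction with
    | ind w ih =>
    -- Each `w` has only countably many predecessors, so the supremum stays below `⊤`.
    obtain ⟨y, hy, hyC⟩ := hcof {z | ∃ v, ∃ _ : v < w, z = nx (x v)}
      (((countable_Iio_omega_one w).image fun v => nx (x v)).mono <| by
        rintro _ ⟨v, hv, rfl⟩
        exact mem_image_of_mem _ hv)
      (by
        rintro _ ⟨v, hv, rfl⟩
        exact hnxt _ (ih v hv))
    exact ((hx w).2 fun z hz => (hyC z hz).le).trans_lt hy
  have hnx_le : ∀ v w, v < w → nx (x v) ≤ x w := fun v w h => (hx w).1 ⟨v, h, rfl⟩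
  refine ⟨x, fun v w h => (hnx _ (hxt v)).trans_le (hnx_le v w h), hxt, fun w z hz => ?_⟩
  obtain ⟨_, ⟨v, hv, rfl⟩, hzv⟩ := (lt_isLUB_iff (hx w)).1 hz
  exact ⟨v, hv, hzv.trans_le (hnx_le v _ (Order.lt_succ v))⟩

/-- The half-open intervals between consecutive terms of the `ω₁`-sequence are copies of `[0,1)`.
They exhaust everything below `⊤`: continuity leaves no gaps, and a bound `z < ⊤` would put an
uncountable increasing family into the order separable `Icc ⊥ z`. -/
theorem nonempty_orderIso_compactLongRay (hsup : ∀ s : Set K, ∃ a, IsLUB s a)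
    (h : ∀ y < (⊤ : K), OrderSeparable (Icc ⊥ y))
    (hcof : ∀ C : Set K, C.Countable → (∀ c ∈ C, c < ⊤) → ∃ y < (⊤ : K), ∀ c ∈ C, c < y) :
    Nonempty (K ≃o CompactLongRay) := by
  have := noMaxOrder_omega_one
  obtain ⟨x, hx, hxt, hlim⟩ := exists_strictMono_omega_one hsup hcof
  have hloc : ∀ z < (⊤ : K), ∃ w, z ∈ Ico (x w) (x (Order.succ w)) := fun z hz => by
    have hex : ∃ w, z < x w := by
      by_contra! hcon
      exact uncountable_omega_one.not_countable
        ((h z hz).countable_of_strictMono hx fun w => ⟨bot_le, hcon w⟩)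
    -- For the least `w` with `z < x w`, `hlim` gives `v < w` with `z < x (succ v)`; minimality
    -- gives `x v ≤ z`.
    obtain ⟨w, hw, hmin⟩ := wellFounded_lt.has_min {w | z < x w} hex
    obtain ⟨v, hv, hzv⟩ := hlim w z hw
    exact ⟨v, not_lt.1 fun hlt => hmin v hlt hv, hzv⟩
  choose F hF hF' using fun w => exists_strictMonoOn_image_Ico hsup (hx (Order.lt_succ w))
    ((h _ (hxt (Order.succ w))).mono (Icc_subset_Icc_left bot_le))
  have hFmem : ∀ w, ∀ t ∈ Ico (0 : ℝ) 1, F w t ∈ Ico (x w) (x (Order.succ w)) := fun w t ht =>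
    hF' w ▸ mem_image_of_mem _ ht
  let φ : CompactLongRay → K :=
    WithTop.recTopCoe ⊤ fun p => F (ofLex p).1 (ofLex p).2
  have hφ : StrictMono φ := by
    intro p q hpq
    induction p using WithTop.recTopCoe with
    | top => exact absurd hpq not_top_lt
    | coe p =>
    induction q using WithTop.recTopCoe with
    | top => exact (hFmem _ _ (ofLex p).2.2).2.trans (hxt _)
    | coe q =>
    rcases Prod.Lex.lt_iff.1 (WithTop.coe_lt_coe.1 hpq) with h1 | ⟨h1, h2⟩
    · exact (hFmem _ _ (ofLex p).2.2).2.trans_le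
        ((hx.monotone (Order.succ_le_of_lt h1)).trans (hFmem _ _ (ofLex q).2.2).1)
    · change F (ofLex p).1 (ofLex p).2 < F (ofLex q).1 (ofLex q).2
      rw [h1]
      exact hF _ (ofLex p).2.2 (ofLex q).2.2 h2
  refine ⟨(hφ.orderIsoOfSurjective φ fun z => ?_).symm⟩
  rcases eq_or_lt_of_le (le_top (a := z)) with rfl | hz
  · exact ⟨⊤, rfl⟩
  · obtain ⟨w, hw⟩ := hloc z hz
    rw [← hF'] at hw
    obtain ⟨t, ht, rfl⟩ := hw
    exact ⟨((toLex (w, ⟨t, ht⟩) : LongRay) : CompactLongRay), rfl⟩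

/-- A complete dense linear order all of whose proper initial segments are order separable is a
copy of the unit interval or of the compact long ray. -/
theorem nonempty_orderIso_Icc_or_compactLongRay [Nontrivial K]
    (hsup : ∀ s : Set K, ∃ a, IsLUB s a) (h : ∀ y < (⊤ : K), OrderSeparable (Icc ⊥ y)) :
    Nonempty (K ≃o Icc (0 : ℝ) 1) ∨ Nonempty (K ≃o CompactLongRay) := by
  by_cases hcof : ∃ C : Set K, C.Countable ∧ (∀ c ∈ C, c < ⊤) ∧ ∀ y < (⊤ : K), ∃ c ∈ C, y ≤ c
  · obtain ⟨C, hC, hCt, hcof⟩ := hcof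
    exact Or.inl (nonempty_orderIso_Icc hsup
      (orderSeparable_univ_of_countable_cofinal h hC hCt hcof))
  · push Not at hcof
    exact Or.inr (nonempty_orderIso_compactLongRay hsup h hcof)

end HalfLine

/-! ### Embeddings witnessing the Valdivia property -/

section Valdivia

/-- A family of increasing maps onto the unit interval that separates points, such that only
countably many of them are nonzero at any given point other than the largest. -/
structure IsValdiviaFamily {K : Type*} [LinearOrder K] {κ : Type*}
    (f : κ → K → unitInterval) : Prop where
  monotone : ∀ i, Monotone (f i)
  surjective : ∀ i, Function.Surjective (f i)
  separates : ∀ x y, x < y → ∃ i, f i x ≠ f i y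
  countable : ∀ x, ¬ IsMax x → {i | f i x ≠ 0}.Countable

variable {K : Type*} [LinearOrder K]

/-- A monotone map with no jumps is continuous; surjectivity is in the structure for this purpose.
-/
theorem IsValdiviaFamily.continuous {κ : Type*} {f : κ → K → unitInterval}
    (h : IsValdiviaFamily f) [TopologicalSpace K] [OrderTopology K] (i : κ) : Continuous (f i) :=
  (h.monotone i).continuous_of_surjective (h.surjective i)

theorem IsValdiviaFamily.comp_orderIso {L κ : Type*} [LinearOrder L] {f : κ → L → unitInterval}
    (h : IsValdiviaFamily f) (e : K ≃o L) : IsValdiviaFamily fun i x => f i (e x) where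
  monotone i := (h.monotone i).comp e.monotone
  surjective i := (h.surjective i).comp e.surjective
  separates _ _ hxy := h.separates _ _ (e.strictMono hxy)
  countable _ hx := h.countable _ fun hm => hx (e.isMax_apply.1 hm)

theorem isValdiviaFamily_unitInterval :
    IsValdiviaFamily fun (_ : Unit) (x : Icc (0 : ℝ) 1) => (x : unitInterval) where
  monotone _ := monotone_id
  surjective _ := Function.surjective_id
  separates _ _ hxy := ⟨(), hxy.ne⟩
  countable _ _ := to_countable _

open Classical in
/-- The map of the compact long ray that collapses everything below and above the `w`-th copy of
`[0, 1)`. -/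
noncomputable def longRayCoord (w : (Ordinal.omega.{0} 1).ToType) : CompactLongRay → unitInterval :=
  WithTop.recTopCoe 1 fun p => if (ofLex p).1 < w then 0 else
    if w < (ofLex p).1 then 1 else ⟨(ofLex p).2, Ico_subset_Icc_self (ofLex p).2.2⟩

theorem longRayCoord_coe_of_lt {w : (Ordinal.omega.{0} 1).ToType} {p : LongRay}
    (h : (ofLex p).1 < w) : longRayCoord w p = 0 := if_pos h

theorem longRayCoord_coe_of_gt {w : (Ordinal.omega.{0} 1).ToType} {p : LongRay}
    (h : w < (ofLex p).1) : longRayCoord w p = 1 :=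
  (if_neg h.not_gt).trans (if_pos h)

theorem longRayCoord_coe_self (p : LongRay) :
    (longRayCoord (ofLex p).1 p : ℝ) = (ofLex p).2 :=
  congrArg Subtype.val ((if_neg (lt_irrefl _)).trans (if_neg (lt_irrefl _)))

theorem monotone_longRayCoord (w : (Ordinal.omega.{0} 1).ToType) : Monotone (longRayCoord w) := by
  refine monotone_iff_forall_lt.2 fun p q hpq => ?_
  induction p using WithTop.recTopCoe with
  | top => exact absurd hpq not_top_lt
  | coe p =>
  induction q using WithTop.recTopCoe with
  | top => exact unitInterval.le_one _
  | coe q =>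
  have hpq := WithTop.coe_lt_coe.1 hpq
  rcases lt_or_ge (ofLex p).1 w with h1 | h1
  · rw [longRayCoord_coe_of_lt h1]
    exact unitInterval.nonneg _
  rcases lt_or_ge w (ofLex q).1 with h2 | h2
  · rw [longRayCoord_coe_of_gt h2]
    exact unitInterval.le_one _
  rcases Prod.Lex.lt_iff.1 hpq with h | ⟨h, h'⟩
  · exact absurd (h1.trans_lt h) h2.not_gt
  · obtain rfl := h1.antisymm (h ▸ h2)
    change (longRayCoord (ofLex p).1 p : ℝ) ≤ longRayCoord (ofLex p).1 q
    rw [longRayCoord_coe_self, h, longRayCoord_coe_self]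
    exact h'.le

theorem isValdiviaFamily_longRayCoord : IsValdiviaFamily longRayCoord where
  monotone := monotone_longRayCoord
  surjective w t := by
    rcases t.2.2.eq_or_lt with ht | ht
    · exact ⟨⊤, Subtype.ext ht.symm⟩
    · exact ⟨((toLex (w, ⟨t, t.2.1, ht⟩) : LongRay) : CompactLongRay),
        Subtype.ext (longRayCoord_coe_self _)⟩
  separates p q hpq := by
    have hne : ∀ p : LongRay, longRayCoord (ofLex p).1 p ≠ 1 := fun p h => by
      have := longRayCoord_coe_self p
      rw [h] at this
      exact (ofLex p).2.2.2.ne this.symm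
    induction p using WithTop.recTopCoe with
    | top => exact absurd hpq not_top_lt
    | coe p =>
    -- The coordinate of the copy containing the smaller point `p` is not `1` at `p`, but is `1` at
    -- every point above that copy.
    refine ⟨(ofLex p).1, ?_⟩
    induction q using WithTop.recTopCoe with
    | top => exact hne p
    | coe q =>
    rcases Prod.Lex.lt_iff.1 (WithTop.coe_lt_coe.1 hpq) with h | ⟨h, h'⟩
    · rw [longRayCoord_coe_of_gt h]
      exact hne p
    · intro heq
      have := congrArg Subtype.val heq
      rw [longRayCoord_coe_self, h, longRayCoord_coe_self] at this
      exact h'.ne (Subtype.ext this)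
  countable p hp := by
    induction p using WithTop.recTopCoe with
    | top => exact absurd isMax_top hp
    | coe p =>
    refine (((countable_Iio_omega_one (ofLex p).1).insert (ofLex p).1)).mono fun w hw => ?_
    rw [Iio_insert, mem_Iic]
    exact le_of_not_gt fun h => hw (longRayCoord_coe_of_lt h)

theorem exists_isValdiviaFamily
    (h : Nonempty (K ≃o Icc (0 : ℝ) 1) ∨ Nonempty (K ≃o CompactLongRay)) :
    ∃ (κ : Type) (f : κ → K → unitInterval), IsValdiviaFamily f := by
  rcases h with ⟨⟨e⟩⟩ | ⟨⟨e⟩⟩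
  · exact ⟨_, _, isValdiviaFamily_unitInterval.comp_orderIso e⟩
  · exact ⟨_, _, isValdiviaFamily_longRayCoord.comp_orderIso e⟩

theorem isValdiviaCompact_of_family {X : Type u} [TopologicalSpace X] [CompactSpace X] {κ : Type}
    (f : κ → X → unitInterval) (hf : ∀ i, Continuous (f i))
    (hsep : ∀ x y, (∀ i, f i x = f i y) → x = y) {A : Set X} (hA : Dense A)
    (hAf : ∀ x ∈ A, {i | f i x ≠ 0}.Countable) : IsValdiviaCompact X := by
  refine ⟨‹_›, ULift.{u} κ, fun x i => f i.down x, ?_, hA.mono fun x hx => ?_⟩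
  · exact (Continuous.isClosedEmbedding (continuous_pi fun i : ULift.{u} κ => hf i.down)
      fun x y hxy => hsep x y fun i => congrFun hxy (ULift.up i)).isEmbedding
  · exact (hAf x hx).preimage ULift.down_injective

/-- Only `⊤` can have uncountable support, and a nontrivial connected order has no isolated points,
so its complement is dense. -/
theorem IsValdiviaFamily.isValdiviaCompact {X : Type u} [LinearOrder X] [TopologicalSpace X]
    [OrderTopology X] [ConnectedSpace X] [Nontrivial X] [CompactSpace X] [OrderTop X] {κ : Type}
    {f : κ → X → unitInterval} (h : IsValdiviaFamily f) : IsValdiviaCompact X := by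
  refine isValdiviaCompact_of_family f h.continuous (fun x y hxy => ?_)
    (dense_compl_singleton (⊤ : X)) fun x hx => h.countable x fun hm => hx (isMax_iff_eq_top.1 hm)
  by_contra hne
  rcases lt_or_gt_of_ne hne with hlt | hlt
  · obtain ⟨i, hi⟩ := h.separates _ _ hlt
    exact hi (hxy i)
  · obtain ⟨i, hi⟩ := h.separates _ _ hlt
    exact hi (hxy i).symm

/-- Valdivia families on both sides of a point give a Valdivia compact space. -/
theorem isValdiviaCompact_of_two_sides {X : Type u} [LinearOrder X] [TopologicalSpace X]
    [OrderTopology X] [ConnectedSpace X] [Nontrivial X] [CompactSpace X] [BoundedOrder X] {m : X}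
    (hm : m ≠ ⊥) (hm' : m ≠ ⊤) {κ κ' : Type} {f : κ → Ici m → unitInterval}
    (hf : IsValdiviaFamily f) {g : κ' → Ici (OrderDual.toDual m) → unitInterval}
    (hg : IsValdiviaFamily g) : IsValdiviaCompact X := by
  let up : X → Ici m := fun x => ⟨max x m, le_max_right x m⟩
  let down : X → Ici (OrderDual.toDual m) := fun x => ⟨OrderDual.toDual (min x m), min_le_right x m⟩
  have hup : Continuous up := (continuous_id.max continuous_const).subtype_mk _
  have hdown : Continuous down :=
    (continuous_toDual.comp (continuous_id.min continuous_const)).subtype_mk _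
  refine isValdiviaCompact_of_family
    (fun i => Sum.elim (fun i x => f i (up x)) (fun j x => g j (down x)) i) ?_ ?_
    ((dense_compl_singleton (⊤ : X)).sdiff_singleton ⊥) ?_
  · rintro (i | j)
    · exact (hf.continuous i).comp hup
    · exact (hg.continuous j).comp hdown
  · have key : ∀ x y, x < y → ∃ i : κ ⊕ κ', Sum.elim (fun i x => f i (up x))
        (fun j x => g j (down x)) i x ≠ Sum.elim (fun i x => f i (up x))
        (fun j x => g j (down x)) i y := by
      intro x y hxy
      -- If the larger point is above `m`, the upper retraction separates the pair; otherwise both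
      -- points are at most `m` and the lower one does.
      rcases lt_or_ge m y with hmy | hmy
      · have : up x < up y :=
          (max_lt (hxy.trans_le (le_max_left y m)) (hmy.trans_le (le_max_left y m)) :
            max x m < max y m)
        obtain ⟨i, hi⟩ := hf.separates _ _ this
        exact ⟨Sum.inl i, hi⟩
      · have : down y < down x := by
          change min x m < min y m
          rw [min_eq_left hmy, min_eq_left (hxy.le.trans hmy)]
          exact hxy
        obtain ⟨i, hi⟩ := hg.separates _ _ this
        exact ⟨Sum.inr i, hi.symm⟩
    intro x y hxy
    by_contra hne
    rcases lt_or_gt_of_ne hne with hlt | hlt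
    · obtain ⟨i, hi⟩ := key _ _ hlt
      exact hi (hxy i)
    · obtain ⟨i, hi⟩ := key _ _ hlt
      exact hi (hxy i).symm
  · rintro x ⟨hxt, hxb⟩
    have h1 : ¬ IsMax (up x) := not_isMax_iff.2
      ⟨⟨⊤, le_top⟩, (max_lt (lt_top_iff_ne_top.2 hxt) (lt_top_iff_ne_top.2 hm') : max x m < ⊤)⟩
    have h2 : ¬ IsMax (down x) := not_isMax_iff.2
      ⟨⟨OrderDual.toDual ⊥, (bot_le : ⊥ ≤ m)⟩,
        (lt_min (bot_lt_iff_ne_bot.2 hxb) (bot_lt_iff_ne_bot.2 hm) : ⊥ < min x m)⟩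
    refine (((hf.countable _ h1).image Sum.inl).union
      ((hg.countable _ h2).image Sum.inr)).mono ?_
    rintro (i | j) hi
    · exact Or.inl ⟨i, hi, rfl⟩
    · exact Or.inr ⟨j, hi, rfl⟩

end Valdivia

/-! ### Gluing the two sides of an interior point -/

section Gluing

/-- The unit interval is isomorphic to its reverse. -/
def unitIntervalDualIso : (Icc (0 : ℝ) 1)ᵒᵈ ≃o Icc (0 : ℝ) 1 where
  toFun x := unitInterval.symm (OrderDual.ofDual x)
  invFun x := OrderDual.toDual (unitInterval.symm x)
  left_inv x := unitInterval.symm_symm (OrderDual.ofDual x)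
  right_inv x := unitInterval.symm_symm x
  map_rel_iff' := sub_le_sub_iff_left (1 : ℝ)

variable {K : Type*} [LinearOrder K]

theorem nonempty_orderIso_longInterval {m : K} (e : Ici m ≃o CompactLongRay)
    (e' : Ici (OrderDual.toDual m) ≃o CompactLongRay) : Nonempty (K ≃o LongInterval) := by
  -- The point `m` is the least element of the reversed lower half, so deleting the minimum of its
  -- long ray removes exactly the second copy of `m`.
  have hlt : ∀ x : {x : CompactLongRay // ¬ IsMin x},
      OrderDual.ofDual (e'.symm x.1 : Kᵒᵈ) < m := fun x => by
    refine lt_of_le_of_ne (e'.symm x.1).2 fun heq => x.2 ?_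
    rw [← e'.symm.isMin_apply]
    intro y _
    change (e'.symm x.1 : Kᵒᵈ) ≤ y
    rw [show (e'.symm x.1 : Kᵒᵈ) = OrderDual.toDual m from heq]
    exact y.2
  let φ : LongInterval → K := fun p => Sum.elim
    (fun x => OrderDual.ofDual (e'.symm (OrderDual.ofDual x).1 : Kᵒᵈ))
    (fun y => (e.symm y : K)) (ofLex p)
  have hφ : StrictMono φ := by
    intro p q hpq
    obtain ⟨p, rfl⟩ := toLex.surjective p
    obtain ⟨q, rfl⟩ := toLex.surjective q
    rcases p with x | y <;> rcases q with x' | y'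
    · have h : x < x' := Sum.Lex.inl_lt_inl_iff.1 hpq
      exact e'.symm.strictMono h
    · exact (hlt (OrderDual.ofDual x)).trans_le (e.symm y').2
    · exact absurd hpq Sum.Lex.not_inr_lt_inl
    · exact e.symm.strictMono (Sum.Lex.inr_lt_inr_iff.1 hpq)
  refine ⟨(hφ.orderIsoOfSurjective φ fun z => ?_).symm⟩
  rcases lt_or_ge z m with hz | hz
  · let z' : Ici (OrderDual.toDual m) := ⟨OrderDual.toDual z, hz.le⟩
    have hmin : ¬ IsMin (e' z') := by
      rw [e'.isMin_apply, not_isMin_iff]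
      exact ⟨⟨OrderDual.toDual m, le_rfl⟩, hz⟩
    refine ⟨toLex (Sum.inl (OrderDual.toDual ⟨e' z', hmin⟩)), ?_⟩
    change OrderDual.ofDual (e'.symm (e' z') : Kᵒᵈ) = z
    rw [e'.symm_apply_apply]
    rfl
  · refine ⟨toLex (Sum.inr (e ⟨z, hz⟩)), ?_⟩
    change (e.symm (e ⟨z, hz⟩) : K) = z
    rw [e.symm_apply_apply]

variable [DenselyOrdered K] [BoundedOrder K]

/-- If `K` is not separable near its top, then its proper final segments are long rays. -/
theorem nonempty_orderIso_Ici_compactLongRay (hsup : ∀ s : Set K, ∃ a, IsLUB s a)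
    (h : ∀ x y : K, x ≠ ⊥ → y ≠ ⊤ → OrderSeparable (Icc x y)) {m : K} (hm : m ≠ ⊥) (hm' : m ≠ ⊤)
    {y : K} (hy : y ≠ ⊥) (hns : ¬ OrderSeparable (Icc y ⊤)) :
    Nonempty (Ici m ≃o CompactLongRay) := by
  have hmt : m < ⊤ := lt_top_iff_ne_top.2 hm'
  have : Nontrivial (Ici m) := ⟨⟨m, le_rfl⟩, ⟨⊤, hmt.le⟩, fun heq => hm' (congrArg Subtype.val heq)⟩
  have hsup' : ∀ s : Set (Ici m), ∃ a, IsLUB s a := fun s => by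
    obtain ⟨a, ha⟩ := hsup (insert m ((↑) '' s))
    refine ⟨⟨a, ha.1 (mem_insert _ _)⟩, fun x hx => ha.1 (Or.inr (mem_image_of_mem _ hx)),
      fun b hb => ha.2 ?_⟩
    rintro _ (rfl | ⟨x, hx, rfl⟩)
    exacts [b.2, hb hx]
  refine (nonempty_orderIso_Icc_or_compactLongRay hsup' fun z hz => ?_).resolve_left fun ⟨e⟩ => ?_
  · have hz' : (z : K) ≠ ⊤ := fun heq => hz.ne (Subtype.ext heq)
    exact (OrderSeparable.preimage_val (t := Ici m) (h m z hm hz')).mono fun w hw => hw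
  -- A copy of `[0,1]` above `m` would make `[m, ⊤]` order separable, and gluing `[y, m]` to it when
  -- `y ≤ m` contradicts `hns`.
  · have h1 : OrderSeparable (Icc m ⊤) :=
      (OrderSeparable.of_orderIso e OrderSeparable.univ_unitInterval).image_val.mono
        fun w hw => ⟨⟨w, hw.1⟩, trivial, rfl⟩
    rcases le_total m y with hmy | hym
    · exact hns (h1.mono (Icc_subset_Icc_left hmy))
    · refine hns (((h y m hy hm').union h1 (m := m) ⟨hym, le_rfl⟩ ⟨le_rfl, le_top⟩
        (fun a ha => ha.2) fun a ha => ha.1).mono ?_)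
      rw [Icc_union_Icc_eq_Icc hym le_top]

end Gluing

/-! ### The classification, by cases on which ends obstruct separability -/

theorem mainTheorem4 (K : Type u) [LinearOrder K] [t : TopologicalSpace K] [OrderTopology K]
    [ConnectedSpace K] (hK : ClassR K t) :
    (Nonempty (K ≃o PUnit.{1}) ∨
      Nonempty (K ≃o Set.Icc (0 : ℝ) 1) ∨
      Nonempty (K ≃o CompactLongRay) ∨
      Nonempty (K ≃o CompactLongRayᵒᵈ) ∨
      Nonempty (K ≃o LongInterval)) ∧
    IsValdiviaCompact K := by
  have hcomp : CompactSpace K := hK.compactSpace_and_t2Space.1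
  have := denselyOrdered_of_preconnectedSpace (α := K)
  rcases subsingleton_or_nontrivial K with hsub | hnt
  · obtain ⟨x⟩ := (inferInstance : Nonempty K)
    have : Unique K := ⟨⟨x⟩, fun y => Subsingleton.elim y x⟩
    refine ⟨Or.inl ⟨OrderIso.ofUnique K PUnit⟩, ?_⟩
    exact isValdiviaCompact_of_family (κ := Empty) (fun i => i.elim) (fun i => i.elim)
      (fun x y _ => Subsingleton.elim x y) dense_univ fun _ _ => to_countable _
  obtain ⟨b, -, hb⟩ := (isCompact_univ (X := K)).exists_isLeast univ_nonempty
  obtain ⟨c, -, hc⟩ := (isCompact_univ (X := K)).exists_isGreatest univ_nonempty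
  let _ : BoundedOrder K :=
    { bot := b, bot_le := fun _ => hb trivial, top := c, le_top := fun _ => hc trivial }
  have hsup : ∀ s : Set K, ∃ a, IsLUB s a := fun s => by
    rcases s.eq_empty_or_nonempty with rfl | hs
    · exact ⟨⊥, isLUB_empty⟩
    · obtain ⟨a, -, ha⟩ := (isClosed_closure (s := s)).isCompact.exists_isLUB hs.closure
      exact ⟨a, by rwa [IsLUB, upperBounds_closure] at ha⟩
  have hsup' : ∀ s : Set Kᵒᵈ, ∃ a, IsLUB s a := fun s => by
    obtain ⟨a, ha⟩ := hsup (lowerBounds (OrderDual.toDual ⁻¹' s))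
    exact ⟨OrderDual.toDual a, (isLUB_lowerBounds.1 ha).dual⟩
  have hsep : ∀ x y : K, x ≠ ⊥ → y ≠ ⊤ → OrderSeparable (Icc x y) := fun x y hx hy =>
    .of_isSeparable (hK.isSeparable_Icc K (Homeomorph.refl K) x y
      (fun h => hx (isMin_iff_eq_bot.1 h)) fun h => hy (isMax_iff_eq_top.1 h))
  -- `h1` says that separability can fail only at the top, `h2` only at the bottom. If both are
  -- false, every interior point `m` has a long ray on each side.
  by_cases h1 : ∀ y < (⊤ : K), OrderSeparable (Icc ⊥ y)
  · have h := nonempty_orderIso_Icc_or_compactLongRay hsup h1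
    obtain ⟨κ, f, hf⟩ := exists_isValdiviaFamily h
    exact ⟨Or.inr (h.imp id Or.inl), hf.isValdiviaCompact⟩
  by_cases h2 : ∀ y : K, ⊥ < y → OrderSeparable (Icc y ⊤)
  · have h := nonempty_orderIso_Icc_or_compactLongRay (K := Kᵒᵈ) hsup' fun y hy =>
      (h2 (OrderDual.ofDual y) hy).dual.mono fun z hz => ⟨hz.2, hz.1⟩
    obtain ⟨κ, f, hf⟩ := exists_isValdiviaFamily h
    have : ConnectedSpace Kᵒᵈ := ‹ConnectedSpace K›
    have : CompactSpace Kᵒᵈ := hcomp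
    -- `K` and its dual have the same topology, so the Valdivia property transfers by definition.
    refine ⟨?_, (hf.isValdiviaCompact : IsValdiviaCompact Kᵒᵈ)⟩
    rcases h with ⟨⟨e⟩⟩ | ⟨⟨e⟩⟩
    · exact Or.inr (Or.inl ⟨(OrderIso.dualDual K).trans (e.dual.trans unitIntervalDualIso)⟩)
    · exact Or.inr (Or.inr (Or.inr (Or.inl ⟨(OrderIso.dualDual K).trans e.dual⟩)))
  push Not at h1 h2
  obtain ⟨y, hy, hyns⟩ := h1
  obtain ⟨z, hz, hzns⟩ := h2
  obtain ⟨m, hm, hm'⟩ := exists_between (bot_lt_top (α := K))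
  obtain ⟨e⟩ := nonempty_orderIso_Ici_compactLongRay hsup hsep hm.ne' hm'.ne hz.ne' hzns
  obtain ⟨e'⟩ := nonempty_orderIso_Ici_compactLongRay (K := Kᵒᵈ) (m := OrderDual.toDual m)
    (y := OrderDual.toDual y) hsup'
    (fun x y hx hy => (hsep (OrderDual.ofDual y) (OrderDual.ofDual x) hy hx).dual.mono
      fun z hz => ⟨hz.2, hz.1⟩) hm'.ne hm.ne' hy.ne
    fun h => hyns (h.dual.mono fun z hz => ⟨hz.2, hz.1⟩)
  obtain ⟨κ, f, hf⟩ := exists_isValdiviaFamily (Or.inr ⟨e⟩)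
  obtain ⟨κ', g, hg⟩ := exists_isValdiviaFamily (Or.inr ⟨e'⟩)
  exact ⟨Or.inr (Or.inr (Or.inr (Or.inr (nonempty_orderIso_longInterval e e')))),
    isValdiviaCompact_of_two_sides hm.ne' hm'.ne hf hg⟩
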